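/- For a positive integer $n$, let $Q(n)$ be the number of partitions of $n$ whose distinct parts form a set of consecutive integers and in which every part other than the largest occurs exactly once (the largest part may be repeated arbitrarily often). For an integer $N\ge 0$, let $H(N)$ be the Hurwitz class number: $H(0)=-\tfrac1{12}$; $H(N)=0$ if $N\equiv 1,2\pmod 4$; and if $N>0$ and $N\equiv 0,3\pmod 4$, then $H(N)$ is the number of $\mathrm{SL}_2(\mathbb Z)$-equivalence classes of positive definite integral binary quadratic forms $ax^2+bxy+cy^2$ (not necessarily primitive) of discriminant $b^2-4ac=-N$, where a class containing a multiple of $x^2+y^2$ is counted with weight $\tfrac12$ and a class containing a multiple of $x^2+xy+y^2$ with weight $\tfrac13$. Then for every integer $n\ge 1$, $$Q(n)=H(8n-1).$$ -/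

import Mathlib

/-- The integral binary quadratic form `a x² + b x y + c y²`. -/
@[ext]
structure BinaryForm where
  a : ℤ
  b : ℤ
  c : ℤ

namespace BinaryForm

/-- The value of the form at `(x, y)`. -/
def eval (f : BinaryForm) (x y : ℤ) : ℤ :=
  f.a * x ^ 2 + f.b * x * y + f.c * y ^ 2

/-- The discriminant `b² - 4 a c`. -/
def disc (f : BinaryForm) : ℤ := f.b ^ 2 - 4 * f.a * f.c

/-- Positive definiteness: the form is positive away from the origin. -/
def PosDef (f : BinaryForm) : Prop :=
  ∀ x y : ℤ, (x, y) ≠ (0, 0) → 0 < f.eval x y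

/-- Two forms are (properly) equivalent if a linear substitution of variables with matrix in
`SL₂(ℤ)` carries one into the other. -/
def Equivalent (f g : BinaryForm) : Prop :=
  ∃ γ : Matrix.SpecialLinearGroup (Fin 2) ℤ, ∀ x y : ℤ,
    g.eval x y = f.eval (γ.1 0 0 * x + γ.1 0 1 * y) (γ.1 1 0 * x + γ.1 1 1 * y)

theorem Equivalent.refl (f : BinaryForm) : f.Equivalent f :=
  ⟨1, fun x y => by simp⟩

theorem Equivalent.symm {f g : BinaryForm} (h : f.Equivalent g) : g.Equivalent f := by
  obtain ⟨γ, h⟩ := h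
  refine ⟨γ⁻¹, fun x y => ?_⟩
  have hd : γ.1 0 0 * γ.1 1 1 - γ.1 0 1 * γ.1 1 0 = 1 := by
    rw [← Matrix.det_fin_two]; exact γ.2
  rw [h, Matrix.SpecialLinearGroup.SL2_inv_expl]
  simp only [Matrix.cons_val', Matrix.cons_val_zero, Matrix.cons_val_one,
    Matrix.cons_val_fin_one]
  congr 1
  · linear_combination (-x) * hd
  · linear_combination (-y) * hd

theorem Equivalent.trans {f g h : BinaryForm} (h₁ : f.Equivalent g) (h₂ : g.Equivalent h) :
    f.Equivalent h := by
  obtain ⟨γ, h₁⟩ := h₁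
  obtain ⟨δ, h₂⟩ := h₂
  refine ⟨γ * δ, fun x y => ?_⟩
  rw [h₂, h₁]
  simp only [Matrix.SpecialLinearGroup.coe_mul, Matrix.mul_apply, Fin.sum_univ_two]
  congr 1 <;> ring

end BinaryForm

/-- The positive definite integral binary quadratic forms (not necessarily primitive) of
discriminant `-N`. -/
def PosDefForm (N : ℕ) : Type :=
  {f : BinaryForm // f.PosDef ∧ f.disc = -(N : ℤ)}

/-- Proper equivalence on the positive definite forms of discriminant `-N`. -/
instance PosDefForm.setoid (N : ℕ) : Setoid (PosDefForm N) where
  r f g := f.1.Equivalent g.1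
  iseqv := ⟨fun f => BinaryForm.Equivalent.refl f.1, fun h => h.symm, fun h h' => h.trans h'⟩

/-- The classes of positive definite binary quadratic forms of discriminant `-N`. -/
def FormClass (N : ℕ) : Type := Quotient (PosDefForm.setoid N)

/-- The class `C` contains the form `f`. -/
def FormClass.Contains {N : ℕ} (C : FormClass N) (f : BinaryForm) : Prop :=
  ∃ F : PosDefForm N, F.1 = f ∧ Quotient.mk (PosDefForm.setoid N) F = C

/-- There are only finitely many classes, so that the sum over the classes in `hurwitzH` below is
a finite sum. -/
instance FormClass.finite (N : ℕ) : Finite (FormClass N) := by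
  have red : ∀ k : ℕ, ∀ f : BinaryForm, f.PosDef → f.disc = -(N : ℤ) → f.a.toNat ≤ k →
      ∃ g : BinaryForm, g.PosDef ∧ g.disc = -(N : ℤ) ∧ f.Equivalent g ∧
        |g.b| ≤ g.a ∧ g.a ≤ g.c := by
    intro k
    induction k with
    | zero =>
      intro f hp _ hk
      have := hp 1 0 (by simp)
      simp [BinaryForm.eval] at this
      omega
    | succ k ih =>
      intro f hp hd hk
      have ha : 0 < f.a := by simpa [BinaryForm.eval] using hp 1 0 (by simp)
      obtain ⟨t, ht⟩ : ∃ t : ℤ, |f.b + 2 * f.a * t| ≤ f.a := by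
        refine ⟨-((f.b + f.a) / (2 * f.a)), ?_⟩
        have h1 := Int.emod_add_mul_ediv (f.b + f.a) (2 * f.a)
        have h2 := Int.emod_nonneg (f.b + f.a) (b := 2 * f.a) (by omega)
        have h3 := Int.emod_lt_of_pos (f.b + f.a) (b := 2 * f.a) (by omega)
        rw [abs_le]
        constructor <;> nlinarith
      have hdet : Matrix.det !![(1 : ℤ), t; 0, 1] = 1 := by simp [Matrix.det_fin_two]
      obtain ⟨g, hg⟩ : ∃ g : BinaryForm, g = ⟨f.a, f.b + 2 * f.a * t, f.eval t 1⟩ := ⟨_, rfl⟩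
      have hev : ∀ x y, g.eval x y = f.eval (x + t * y) y := by
        intro x y; subst hg; simp only [BinaryForm.eval]; ring
      have hfg : f.Equivalent g := ⟨⟨_, hdet⟩, fun x y => by simp [hev]⟩
      have hgp : g.PosDef := by
        intro x y hxy
        rw [hev]
        apply hp
        intro h
        simp only [Prod.mk.injEq] at h
        apply hxy
        obtain ⟨h1, h2⟩ := h
        subst h2
        simpa using h1
      have hgd : g.disc = -(N : ℤ) := by
        rw [← hd]; subst hg; simp only [BinaryForm.disc, BinaryForm.eval]; ring
      have hga : g.a = f.a := by rw [hg]
      have hgb : |g.b| ≤ g.a := by rw [hg]; exact ht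
      by_cases hc : g.a ≤ g.c
      · exact ⟨g, hgp, hgd, hfg, hgb, hc⟩
      · have hdet' : Matrix.det !![(0 : ℤ), -1; 1, 0] = 1 := by simp [Matrix.det_fin_two]
        obtain ⟨h, hh⟩ : ∃ h : BinaryForm, h = ⟨g.c, -g.b, g.a⟩ := ⟨_, rfl⟩
        have hev' : ∀ x y, h.eval x y = g.eval (-y) x := by
          intro x y; subst hh; simp only [BinaryForm.eval]; ring
        have hgh : g.Equivalent h := ⟨⟨_, hdet'⟩, fun x y => by simp [hev']⟩
        have hhp : h.PosDef := by
          intro x y hxy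
          rw [hev']
          apply hgp
          intro h
          apply hxy
          simp only [Prod.mk.injEq, neg_eq_zero] at h ⊢
          exact ⟨h.2, h.1⟩
        have hhd : h.disc = -(N : ℤ) := by
          rw [← hgd]; subst hh; simp only [BinaryForm.disc]; ring
        have hha : h.a = g.c := by rw [hh]
        obtain ⟨r, hr1, hr2, hr3, hr4⟩ := ih h hhp hhd (by omega)
        exact ⟨r, hr1, hr2, (hfg.trans hgh).trans hr3, hr4⟩
  let S : Set (PosDefForm N) := {F | |F.1.b| ≤ F.1.a ∧ F.1.a ≤ F.1.c}
  have hS : Finite S := by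
    let φ : S → Set.Icc (-(N : ℤ)) N × Set.Icc (-(N : ℤ)) N × Set.Icc (-(N : ℤ)) N := fun F => by
      have key : 0 < F.1.1.a ∧ |F.1.1.b| ≤ F.1.1.a ∧ F.1.1.a ≤ F.1.1.c ∧ F.1.1.c ≤ N := by
        obtain ⟨⟨⟨a, b, c⟩, hp, hd⟩, hb, hc⟩ := F
        have ha : 0 < a := by simpa [BinaryForm.eval] using hp 1 0 (by simp)
        simp only [BinaryForm.disc] at hd hb hc ⊢
        refine ⟨ha, hb, hc, ?_⟩
        have := abs_le.1 hb
        nlinarith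
      have key' := abs_le.1 key.2.1
      exact ⟨⟨F.1.1.a, by constructor <;> omega⟩, ⟨F.1.1.b, by constructor <;> omega⟩,
        ⟨F.1.1.c, by constructor <;> omega⟩⟩
    apply Finite.of_injective φ
    intro F G h
    simp only [φ, Prod.mk.injEq] at h
    exact Subtype.ext (Subtype.ext (BinaryForm.ext
      (congrArg Subtype.val h.1) (congrArg Subtype.val h.2.1) (congrArg Subtype.val h.2.2)))
  apply Finite.of_surjective (fun F : S => (Quotient.mk (PosDefForm.setoid N) F.1 : FormClass N))
  intro C
  obtain ⟨F, rfl⟩ := Quotient.exists_rep C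
  obtain ⟨g, hp, hd, he, hb⟩ := red _ F.1 F.2.1 F.2.2 le_rfl
  exact ⟨⟨⟨g, hp, hd⟩, hb⟩, Quotient.sound he.symm⟩

open Classical in
/-- The weight of a class: `1/2` if it contains a multiple of `x² + y²`, `1/3` if it contains a
multiple of `x² + x y + y²`, and `1` otherwise. -/
noncomputable def FormClass.weight {N : ℕ} (C : FormClass N) : ℚ :=
  if ∃ m : ℤ, C.Contains ⟨m, 0, m⟩ then 1 / 2
  else if ∃ m : ℤ, C.Contains ⟨m, m, m⟩ then 1 / 3
  else 1

/-- The Hurwitz class number `H(N)`. -/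
noncomputable def hurwitzH (N : ℕ) : ℚ :=
  if N = 0 then -1 / 12
  else if N % 4 = 1 ∨ N % 4 = 2 then 0
  else ∑ᶠ C : FormClass N, C.weight

/-- The parts of the partition are consecutive integers (no gap between two parts), and every part
other than the largest one occurs exactly once. -/
def IsConsecutiveSingletons {n : ℕ} (p : n.Partition) : Prop :=
  (∀ a ∈ p.parts, ∀ b ∈ p.parts, ∀ k : ℕ, a ≤ k → k ≤ b → k ∈ p.parts) ∧
  (∀ a ∈ p.parts, (∃ b ∈ p.parts, a < b) → p.parts.count a = 1)

/-- `Q(n)`: the number of partitions of `n` into consecutive parts, all singletons except the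
largest. -/
noncomputable def partitionQ (n : ℕ) : ℕ :=
  Nat.card {p : n.Partition // IsConsecutiveSingletons p}

namespace BinaryForm

theorem PosDef.a_pos {f : BinaryForm} (h : f.PosDef) : 0 < f.a := by
  simpa [eval] using h 1 0 (by simp)

theorem posDef_of_disc_neg {f : BinaryForm} (ha : 0 < f.a) (hd : f.disc < 0) : f.PosDef := by
  intro x y hxy
  have key : 4 * f.a * f.eval x y = (2 * f.a * x + f.b * y) ^ 2 + -f.disc * y ^ 2 := by
    simp only [eval, disc]; ring
  have hpos : 0 < 4 * f.a * f.eval x y := by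
    rw [key]
    rcases eq_or_ne y 0 with rfl | hy
    · have hx : x ≠ 0 := fun h => hxy (by rw [h])
      have : 0 < (2 * f.a * x) ^ 2 := by positivity
      simpa using this
    · have h1 : 0 < -f.disc := by omega
      positivity
  exact pos_of_mul_pos_right hpos (by omega)

theorem Equivalent.exists_coeff {f g : BinaryForm} (h : f.Equivalent g) :
    ∃ p q r s : ℤ, p * s - q * r = 1 ∧ g.a = f.a * p ^ 2 + f.b * p * r + f.c * r ^ 2 ∧
      g.b = 2 * f.a * p * q + f.b * (p * s + q * r) + 2 * f.c * r * s ∧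
      g.c = f.a * q ^ 2 + f.b * q * s + f.c * s ^ 2 := by
  obtain ⟨γ, h⟩ := h
  have hdet : γ.1 0 0 * γ.1 1 1 - γ.1 0 1 * γ.1 1 0 = 1 := by
    rw [← Matrix.det_fin_two]; exact γ.2
  have h10 := h 1 0
  have h01 := h 0 1
  have h11 := h 1 1
  simp only [eval] at h10 h01 h11
  refine ⟨_, _, _, _, hdet, ?_, ?_, ?_⟩
  · linear_combination h10
  · linear_combination h11 - h10 - h01
  · linear_combination h01

theorem Equivalent.disc_eq {f g : BinaryForm} (h : f.Equivalent g) : g.disc = f.disc := by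
  obtain ⟨p, q, r, s, hdet, ha, hb, hc⟩ := h.exists_coeff
  simp only [disc, ha, hb, hc]
  linear_combination (f.b ^ 2 - 4 * f.a * f.c) * (p * s - q * r + 1) * hdet

theorem Equivalent.posDef {f g : BinaryForm} (h : f.Equivalent g) (hf : f.PosDef) :
    g.PosDef := by
  obtain ⟨γ, h⟩ := h
  have hdet : γ.1 0 0 * γ.1 1 1 - γ.1 0 1 * γ.1 1 0 = 1 := by
    rw [← Matrix.det_fin_two]; exact γ.2
  intro x y hxy
  rw [h]
  refine hf _ _ fun h0 => hxy ?_
  simp only [Prod.mk.injEq] at h0 ⊢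
  constructor
  · linear_combination γ.1 1 1 * h0.1 - γ.1 0 1 * h0.2 - x * hdet
  · linear_combination γ.1 0 0 * h0.2 - γ.1 1 0 * h0.1 - y * hdet

theorem equivalent_shift (f : BinaryForm) (t : ℤ) :
    f.Equivalent ⟨f.a, f.b + 2 * f.a * t, f.eval t 1⟩ := by
  have hdet : Matrix.det !![(1 : ℤ), t; 0, 1] = 1 := by simp [Matrix.det_fin_two]
  refine ⟨⟨_, hdet⟩, fun x y => ?_⟩
  simp [eval]
  ring

theorem equivalent_swap (f : BinaryForm) : f.Equivalent ⟨f.c, -f.b, f.a⟩ := by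
  have hdet : Matrix.det !![(0 : ℤ), -1; 1, 0] = 1 := by simp [Matrix.det_fin_two]
  refine ⟨⟨_, hdet⟩, fun x y => ?_⟩
  simp [eval]
  ring

/-- Gauss reduced positive definite forms. -/
structure IsReduced (f : BinaryForm) : Prop where
  a_pos : 0 < f.a
  neg_a_lt_b : -f.a < f.b
  b_le_a : f.b ≤ f.a
  a_le_c : f.a ≤ f.c
  b_nonneg : f.a = f.c → 0 ≤ f.b

theorem PosDef.exists_small {f : BinaryForm} (hf : f.PosDef) :
    ∃ g : BinaryForm, f.Equivalent g ∧ -g.a < g.b ∧ g.b ≤ g.a ∧ g.a ≤ g.c := by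
  induction hk : f.a.toNat using Nat.strong_induction_on generalizing f with
  | _ k ih =>
    have ha := hf.a_pos
    obtain ⟨t, ht1, ht2⟩ : ∃ t : ℤ, -f.a < f.b + 2 * f.a * t ∧ f.b + 2 * f.a * t ≤ f.a := by
      refine ⟨(f.a - f.b) / (2 * f.a), ?_⟩
      have h1 := Int.emod_add_mul_ediv (f.a - f.b) (2 * f.a)
      have h2 := Int.emod_nonneg (f.a - f.b) (b := 2 * f.a) (by omega)
      have h3 := Int.emod_lt_of_pos (f.a - f.b) (b := 2 * f.a) (by omega)
      constructor <;> linarith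
    have hfg := f.equivalent_shift t
    by_cases hc : f.a ≤ f.eval t 1
    · exact ⟨_, hfg, ht1, ht2, hc⟩
    · have hfh := hfg.trans (equivalent_swap _)
      have hh := hfh.posDef hf
      have hpos : 0 < f.eval t 1 := hh.a_pos
      obtain ⟨g, hg, h⟩ := ih _ (by simp only at hpos ⊢; omega) hh rfl
      exact ⟨g, hfh.trans hg, h⟩

theorem PosDef.exists_isReduced {f : BinaryForm} (hf : f.PosDef) :
    ∃ g : BinaryForm, f.Equivalent g ∧ g.IsReduced := by
  obtain ⟨g, hg, h1, h2, h3⟩ := hf.exists_small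
  have ha := (hg.posDef hf).a_pos
  by_cases h : g.a = g.c ∧ g.b < 0
  · exact ⟨_, hg.trans g.equivalent_swap, by simp only; omega, by simp only; omega,
      by simp only; omega, by simp only; omega, fun _ => by simp only; omega⟩
  · exact ⟨g, hg, ha, h1, h2, h3, fun _ => by omega⟩

theorem IsReduced.le_value {f : BinaryForm} (hf : f.IsReduced) (p r : ℤ)
    (hpr : p ≠ 0 ∨ r ≠ 0) :
    f.a + (f.c - f.a) * r ^ 2 ≤ f.a * p ^ 2 + f.b * p * r + f.c * r ^ 2 := by
  obtain ⟨ha, hb1, hb2, hc, -⟩ := hf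
  have h1 : 1 ≤ p ^ 2 - |p * r| + r ^ 2 := by
    have h2 : |p * r| * 2 ≤ p ^ 2 + r ^ 2 := by
      rw [abs_mul]
      nlinarith [sq_nonneg (|p| - |r|), sq_abs p, sq_abs r]
    have h3 : 0 < p ^ 2 + r ^ 2 := by
      rcases hpr with h | h <;> positivity
    rcases eq_or_ne (p * r) 0 with h | h
    · rw [h, abs_zero]; omega
    · have := abs_pos.2 h
      omega
  have h4 : |f.b * (p * r)| ≤ f.a * |p * r| := by
    rw [abs_mul]
    exact mul_le_mul_of_nonneg_right (abs_le.2 ⟨hb1.le, hb2⟩) (abs_nonneg _)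
  have h5 := (abs_le.1 h4).1
  nlinarith [mul_le_mul_of_nonneg_left h1 ha.le]

theorem IsReduced.a_le_of_equivalent {f g : BinaryForm} (hf : f.IsReduced)
    (h : f.Equivalent g) : f.a ≤ g.a := by
  obtain ⟨p, q, r, s, hdet, ha, -, -⟩ := h.exists_coeff
  have h1 := hf.le_value p r (by
    by_contra! h0
    simp [h0.1, h0.2] at hdet)
  have h2 : 0 ≤ (f.c - f.a) * r ^ 2 :=
    mul_nonneg (by have := hf.a_le_c; omega) (sq_nonneg r)
  omega

theorem IsReduced.b_eq_of_equivalent {f g : BinaryForm} (hf : f.IsReduced) (hg : g.IsReduced)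
    (h : f.Equivalent g) (haa : f.a = g.a) (hac : f.a < f.c) : f.b = g.b := by
  obtain ⟨p, q, r, s, hdet, ha, hb, -⟩ := h.exists_coeff
  have h1 := hf.le_value p r (by
    by_contra! h0
    simp [h0.1, h0.2] at hdet)
  have hr : r = 0 := by
    by_contra hr
    have : 0 < (f.c - f.a) * r ^ 2 := mul_pos (by omega) (by positivity)
    omega
  subst hr
  have hps : p * s = 1 := by linear_combination hdet
  have hb' : g.b = f.b + 2 * f.a * (p * q) := by linear_combination hb + f.b * hps
  obtain ⟨ha0, h2, h3, -, -⟩ := hf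
  obtain ⟨-, h4, h5, -, -⟩ := hg
  have h6 : p * q < 1 := by by_contra! h; nlinarith
  have h7 : -1 < p * q := by by_contra! h; nlinarith
  have h8 : p * q = 0 := by omega
  rw [hb', h8]; ring

theorem IsReduced.eq_of_equivalent {f g : BinaryForm} (hf : f.IsReduced) (hg : g.IsReduced)
    (h : f.Equivalent g) : f = g := by
  have ha : f.a = g.a := le_antisymm (hf.a_le_of_equivalent h) (hg.a_le_of_equivalent h.symm)
  have hd := h.disc_eq
  simp only [disc] at hd
  have hb : f.b = g.b := by
    rcases hf.a_le_c.lt_or_eq with hc | hc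
    · exact hf.b_eq_of_equivalent hg h ha hc
    rcases hg.a_le_c.lt_or_eq with hc' | hc'
    · exact (hg.b_eq_of_equivalent hf h.symm ha.symm hc').symm
    · have hb2 : f.b ^ 2 = g.b ^ 2 := by
        rw [← hc, ← hc', ← ha] at hd
        linear_combination -hd
      exact (pow_left_inj₀ (hf.b_nonneg hc) (hg.b_nonneg hc') two_ne_zero).1 hb2
  refine BinaryForm.ext ha hb ?_
  have ha0 : f.a ≠ 0 := hf.a_pos.ne'
  rw [← ha, ← hb] at hd
  refine mul_left_cancel₀ ha0 ?_
  linarith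

theorem parity_of_disc {f : BinaryForm} {n : ℕ} (h : f.disc = -(8 * n - 1)) :
    f.b % 2 = 1 ∧ (f.a % 2 = 0 ∨ f.c % 2 = 0) := by
  simp only [disc] at h
  have hb : f.b % 2 = 1 := by
    by_contra hb
    obtain ⟨k, hk⟩ : ∃ k, f.b = 2 * k := ⟨f.b / 2, by omega⟩
    have : 4 * (k ^ 2 - f.a * f.c + 2 * n) = 1 := by rw [hk] at h; linear_combination h
    omega
  refine ⟨hb, ?_⟩
  by_contra! hac
  obtain ⟨k, hk⟩ : ∃ k, f.b = 2 * k + 1 := ⟨f.b / 2, by omega⟩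
  obtain ⟨l, hl⟩ : ∃ l, f.a = 2 * l + 1 := ⟨f.a / 2, by omega⟩
  obtain ⟨m, hm⟩ : ∃ m, f.c = 2 * m + 1 := ⟨f.c / 2, by omega⟩
  obtain ⟨e, he⟩ := (Int.even_mul_succ_self k)
  have : 4 * (2 * e - 4 * (l * m) - 2 * l - 2 * m - 1 + 2 * n) = 0 := by
    rw [hk, hl, hm] at h; linear_combination h - 4 * he
  omega

/-- Forms with even leading coefficient whose root lies in the left half of the standard
fundamental domain of `Γ₀(2)`. -/
structure IsReducedTwo (f : BinaryForm) : Prop where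
  a_even : f.a % 2 = 0
  b_pos : 0 < f.b
  b_lt_a : f.b < f.a
  b_lt_two_c : f.b < 2 * f.c

/-- The map from `Γ₀(2)`-reduced forms to reduced forms. -/
def toReduced (f : BinaryForm) : BinaryForm :=
  if f.a ≤ f.c then f
  else if f.b ≤ f.c then
    if f.c % 2 = 1 then ⟨f.c, f.b, f.a⟩ else ⟨f.c, -f.b, f.a⟩
  else ⟨f.c, f.b - 2 * f.c, f.a - f.b + f.c⟩

/-- The map from reduced forms to `Γ₀(2)`-reduced forms. -/
def toReducedTwo (f : BinaryForm) : BinaryForm :=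
  if 0 < f.b then
    if f.a % 2 = 0 then f else ⟨f.c, f.b, f.a⟩
  else if f.a % 2 = 0 ∧ f.c % 2 = 0 then ⟨f.c, -f.b, f.a⟩
  else ⟨f.a + f.b + f.c, 2 * f.a + f.b, f.a⟩

theorem disc_toReduced (f : BinaryForm) : f.toReduced.disc = f.disc := by
  unfold toReduced
  split_ifs <;> simp only [disc] <;> ring

theorem disc_toReducedTwo (f : BinaryForm) : f.toReducedTwo.disc = f.disc := by
  unfold toReducedTwo
  split_ifs <;> simp only [disc] <;> ring

theorem IsReducedTwo.isReduced {f : BinaryForm} {n : ℕ} (hf : f.IsReducedTwo)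
    (hd : f.disc = -(8 * n - 1)) : f.toReduced.IsReduced := by
  obtain ⟨h1, h2, h3, h4⟩ := hf
  obtain ⟨h5, -⟩ := parity_of_disc hd
  unfold toReduced
  split_ifs <;> constructor <;> (try simp only) <;> omega

theorem IsReduced.isReducedTwo {f : BinaryForm} {n : ℕ} (hf : f.IsReduced)
    (hd : f.disc = -(8 * n - 1)) : f.toReducedTwo.IsReducedTwo := by
  obtain ⟨h1, h2, h3, h4, h5⟩ := hf
  obtain ⟨h6, h7⟩ := parity_of_disc hd
  unfold toReducedTwo
  split_ifs <;> constructor <;> (try simp only) <;> omega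

theorem IsReducedTwo.toReducedTwo_toReduced {f : BinaryForm} {n : ℕ} (hf : f.IsReducedTwo)
    (hd : f.disc = -(8 * n - 1)) : f.toReduced.toReducedTwo = f := by
  obtain ⟨h1, h2, h3, h4⟩ := hf
  obtain ⟨h5, -⟩ := parity_of_disc hd
  unfold toReduced
  split_ifs <;> unfold toReducedTwo <;> (try simp only) <;> split_ifs <;>
    first | omega | (ext <;> (try simp only) <;> omega)

theorem IsReduced.toReduced_toReducedTwo {f : BinaryForm} {n : ℕ} (hf : f.IsReduced)
    (hd : f.disc = -(8 * n - 1)) : f.toReducedTwo.toReduced = f := by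
  obtain ⟨h1, h2, h3, h4, h5⟩ := hf
  obtain ⟨h6, h7⟩ := parity_of_disc hd
  unfold toReducedTwo
  split_ifs <;> unfold toReduced <;> (try simp only) <;> split_ifs <;>
    first | omega | (ext <;> (try simp only) <;> omega)

/-- Reduced forms of discriminant `1 - 8n` correspond to `Γ₀(2)`-reduced ones. -/
def reducedTwoEquiv (n : ℕ) :
    {f : BinaryForm // f.IsReducedTwo ∧ f.disc = -(8 * n - 1)} ≃
      {f : BinaryForm // f.IsReduced ∧ f.disc = -(8 * n - 1)} where
  toFun f := ⟨f.1.toReduced, f.2.1.isReduced f.2.2, (disc_toReduced _).trans f.2.2⟩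
  invFun f := ⟨f.1.toReducedTwo, f.2.1.isReducedTwo f.2.2, (disc_toReducedTwo _).trans f.2.2⟩
  left_inv f := Subtype.ext (f.2.1.toReducedTwo_toReduced f.2.2)
  right_inv f := Subtype.ext (f.2.1.toReduced_toReducedTwo f.2.2)

end BinaryForm

theorem FormClass.card_eq_card_isReduced {N : ℕ} (hN : 0 < N) :
    Nat.card (FormClass N) = Nat.card {f : BinaryForm // f.IsReduced ∧ f.disc = -(N : ℤ)} := by
  symm
  let φ (f : {f : BinaryForm // f.IsReduced ∧ f.disc = -(N : ℤ)}) : PosDefForm N :=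
    ⟨f.1, BinaryForm.posDef_of_disc_neg f.2.1.a_pos (by rw [f.2.2]; omega), f.2.2⟩
  refine Nat.card_eq_of_bijective
    (fun f => (Quotient.mk (PosDefForm.setoid N) (φ f) : FormClass N)) ⟨fun f g h => ?_, fun C => ?_⟩
  · have h' : f.1.Equivalent g.1 := Quotient.exact h
    exact Subtype.ext (f.2.1.eq_of_equivalent g.2.1 h')
  · obtain ⟨F, rfl⟩ := Quotient.exists_rep C
    obtain ⟨g, hg, hr⟩ := F.2.1.exists_isReduced
    exact ⟨⟨g, hr, hg.disc_eq.trans F.2.2⟩, Quotient.sound hg.symm⟩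

theorem FormClass.weight_eq_one {N : ℕ} (hN : N % 8 = 7) (C : FormClass N) : C.weight = 1 := by
  unfold FormClass.weight
  rw [if_neg, if_neg]
  · rintro ⟨m, F, hF, -⟩
    have hd := F.2.2
    rw [hF] at hd
    simp only [BinaryForm.disc] at hd
    have h3 : 3 * m ^ 2 = N := by linear_combination -hd
    obtain ⟨k, hk | hk⟩ := Int.even_or_odd' m
    · have : 4 * (3 * k ^ 2) = (N : ℤ) := by rw [← h3, hk]; ring
      omega
    · obtain ⟨e, he⟩ := Int.even_mul_succ_self k
      have : 24 * e + 3 = (N : ℤ) := by rw [← h3, hk]; linear_combination -12 * he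
      omega
  · rintro ⟨m, F, hF, -⟩
    have hd := F.2.2
    rw [hF] at hd
    simp only [BinaryForm.disc] at hd
    have : 4 * m ^ 2 = (N : ℤ) := by linear_combination -hd
    omega

theorem hurwitzH_eq_card {N : ℕ} (hN : N % 8 = 7) : hurwitzH N = Nat.card (FormClass N) := by
  unfold hurwitzH
  rw [if_neg (by omega), if_neg (by omega)]
  simp only [FormClass.weight_eq_one hN]
  have := Fintype.ofFinite (FormClass N)
  simp [finsum_eq_sum_of_fintype]

/-- The multiset `k, k + 1, …, L - 1` followed by `r` copies of `L`. -/
def consecutiveParts (k L r : ℕ) : Multiset ℕ :=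
  (Finset.Ico k L).val + Multiset.replicate r L

theorem count_consecutiveParts (k L r x : ℕ) :
    (consecutiveParts k L r).count x = (if k ≤ x ∧ x < L then 1 else 0) + if x = L then r else 0 := by
  simp only [consecutiveParts, Multiset.count_add, Multiset.count_replicate,
    Multiset.count_eq_of_nodup (Finset.nodup _), Finset.mem_val, Finset.mem_Ico, eq_comm]

theorem mem_consecutiveParts {k L r x : ℕ} (hk : k ≤ L) (hr : 0 < r) :
    x ∈ consecutiveParts k L r ↔ k ≤ x ∧ x ≤ L := by
  simp only [consecutiveParts, Multiset.mem_add, Finset.mem_val, Finset.mem_Ico,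
    Multiset.mem_replicate]
  omega

theorem two_mul_sum_consecutiveParts {k L r : ℕ} (hk : k ≤ L) :
    (2 * (consecutiveParts k L r).sum : ℤ) = (L - k) * (L + k - 1) + 2 * (r * L) := by
  have h : (2 * ((Finset.Ico k L).val.sum : ℕ) : ℤ) = (L - k) * (L + k - 1) := by
    rw [Finset.sum_val]
    induction L, hk using Nat.le_induction with
    | base => simp
    | succ L hk ih =>
      rw [Finset.sum_Ico_succ_top hk]
      push_cast at ih ⊢
      simp only [id] at ih ⊢
      linear_combination ih
  rw [consecutiveParts, Multiset.sum_add, Multiset.sum_replicate]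
  rw [Nat.cast_add, mul_add, h, smul_eq_mul, Nat.cast_mul]

/-- The data of a partition into consecutive parts, all singletons except the largest. -/
def ConsecutiveData (n : ℕ) : Type :=
  {t : ℕ × ℕ × ℕ // 0 < t.1 ∧ t.1 ≤ t.2.1 ∧ 0 < t.2.2 ∧
    (consecutiveParts t.1 t.2.1 t.2.2).sum = n}

theorem isConsecutiveSingletons_of_parts_eq {n k L r : ℕ} {p : n.Partition} (hk : k ≤ L)
    (hr : 0 < r) (hp : p.parts = consecutiveParts k L r) : IsConsecutiveSingletons p := by
  unfold IsConsecutiveSingletons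
  simp only [hp, mem_consecutiveParts hk hr, count_consecutiveParts]
  refine ⟨fun a ha b hb x hax hxb => by omega, ?_⟩
  rintro a ha ⟨b, hb, hab⟩
  rw [if_pos (by omega), if_neg (by omega)]

theorem IsConsecutiveSingletons.exists_parts_eq {n : ℕ} (hn : n ≠ 0) {p : n.Partition}
    (hp : IsConsecutiveSingletons p) :
    ∃ k L r, 0 < k ∧ k ≤ L ∧ 0 < r ∧ p.parts = consecutiveParts k L r := by
  have hne : p.parts.toFinset.Nonempty := by
    rw [Multiset.toFinset_nonempty]
    intro h
    have := p.parts_sum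
    rw [h, Multiset.sum_zero] at this
    exact hn this.symm
  obtain ⟨k, hkm, hk⟩ := p.parts.toFinset.exists_min_image id hne
  obtain ⟨L, hLm, hL⟩ := p.parts.toFinset.exists_max_image id hne
  simp only [Multiset.mem_toFinset, id] at hkm hk hLm hL
  refine ⟨k, L, p.parts.count L, p.parts_pos hkm, hk L hLm, Multiset.count_pos.2 hLm, ?_⟩
  ext x
  rw [count_consecutiveParts]
  by_cases hx : k ≤ x ∧ x < L
  · rw [if_pos hx, if_neg (by omega)]
    exact hp.2 x (hp.1 k hkm L hLm x hx.1 hx.2.le) ⟨L, hLm, hx.2⟩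
  · rw [if_neg hx]
    split_ifs with h
    · rw [h, zero_add]
    · rw [Multiset.count_eq_zero]
      intro hm
      have := hk x hm
      have := hL x hm
      omega

theorem consecutiveParts_injective {k L r k' L' r' : ℕ} (hk : k ≤ L) (hr : 0 < r) (hk' : k' ≤ L')
    (hr' : 0 < r') (h : consecutiveParts k L r = consecutiveParts k' L' r') :
    k = k' ∧ L = L' ∧ r = r' := by
  have hm (x : ℕ) : k ≤ x ∧ x ≤ L ↔ k' ≤ x ∧ x ≤ L' := by
    rw [← mem_consecutiveParts hk hr, h, mem_consecutiveParts hk' hr']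
  have h1 := hm k
  have h2 := hm k'
  have h3 := hm L
  have h4 := hm L'
  have hL : L = L' := by omega
  refine ⟨by omega, hL, ?_⟩
  have := congrArg (Multiset.count L) h
  simpa [count_consecutiveParts, ← hL] using this

theorem partitionQ_eq_card {n : ℕ} (hn : n ≠ 0) : partitionQ n = Nat.card (ConsecutiveData n) := by
  symm
  let φ (t : ConsecutiveData n) : n.Partition :=
    ⟨consecutiveParts t.1.1 t.1.2.1 t.1.2.2, fun {i} hi => by
      have := (mem_consecutiveParts t.2.2.1 t.2.2.2.1).1 hi
      have := t.2.1
      omega, t.2.2.2.2⟩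
  refine Nat.card_eq_of_bijective (fun t => (⟨φ t, isConsecutiveSingletons_of_parts_eq t.2.2.1
    t.2.2.2.1 rfl⟩ : {p : n.Partition // IsConsecutiveSingletons p})) ⟨fun t u h => ?_, ?_⟩
  · have h' : consecutiveParts t.1.1 t.1.2.1 t.1.2.2 = consecutiveParts u.1.1 u.1.2.1 u.1.2.2 :=
      congrArg (fun p => p.1.parts) h
    obtain ⟨h1, h2, h3⟩ :=
      consecutiveParts_injective t.2.2.1 t.2.2.2.1 u.2.2.1 u.2.2.2.1 h'
    exact Subtype.ext (Prod.ext h1 (Prod.ext h2 h3))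
  · rintro ⟨p, hp⟩
    obtain ⟨k, L, r, h1, h2, h3, h4⟩ := hp.exists_parts_eq hn
    exact ⟨⟨(k, L, r), h1, h2, h3, h4 ▸ p.parts_sum⟩,
      Subtype.ext (Nat.Partition.ext h4.symm)⟩

theorem card_consecutiveData (n : ℕ) :
    Nat.card (ConsecutiveData n) =
      Nat.card {f : BinaryForm // f.IsReducedTwo ∧ f.disc = -(8 * n - 1)} := by
  refine Nat.card_eq_of_bijective
    (fun t => ⟨⟨2 * t.1.2.1, 2 * (t.1.2.1 - t.1.1) + 1, t.1.2.1 - t.1.1 + t.1.2.2⟩, ?_, ?_⟩)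
    ⟨?_, ?_⟩
  · obtain ⟨⟨k, L, r⟩, h1, h2, h3, -⟩ := t
    simp only at h1 h2 h3
    constructor <;> simp only <;> omega
  · obtain ⟨⟨k, L, r⟩, h1, h2, h3, h4⟩ := t
    have h := two_mul_sum_consecutiveParts (r := r) h2
    simp only at h4
    rw [h4] at h
    simp only at h
    simp only [BinaryForm.disc]
    linear_combination 4 * h
  · rintro ⟨⟨k, L, r⟩, h1, h2, h3, h4⟩ ⟨⟨k', L', r'⟩, h1', h2', h3', h4'⟩ h
    simp only [Subtype.mk.injEq, BinaryForm.mk.injEq] at h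
    simp only at h1 h2 h3 h1' h2' h3'
    apply Subtype.ext
    simp only [Prod.mk.injEq]
    omega
  · rintro ⟨⟨A, B, C⟩, hf, hd⟩
    obtain ⟨hB, -⟩ := BinaryForm.parity_of_disc hd
    obtain ⟨h1, h2, h3, h4⟩ := hf
    simp only [BinaryForm.disc] at hB h1 h2 h3 h4 hd
    obtain ⟨L, rfl⟩ : ∃ L : ℕ, A = 2 * L := ⟨(A / 2).toNat, by omega⟩
    obtain ⟨s, rfl⟩ : ∃ s : ℕ, B = 2 * s + 1 := ⟨(B / 2).toNat, by omega⟩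
    obtain ⟨k, rfl⟩ : ∃ k : ℕ, L = k + s := ⟨L - s, by omega⟩
    obtain ⟨r, rfl⟩ : ∃ r : ℕ, C = s + r := ⟨(C - s).toNat, by omega⟩
    refine ⟨⟨(k, k + s, r), by simp only; omega, by simp only; omega, by simp only; omega, ?_⟩, ?_⟩
    · have h := two_mul_sum_consecutiveParts (k := k) (L := k + s) (r := r) (by omega)
      have h' : (8 * (consecutiveParts k (k + s) r).sum : ℤ) = 8 * n := by
        simp only [Nat.cast_add] at h hd
        linear_combination 4 * h - hd
      simp only
      omega
    · apply Subtype.ext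
      ext <;> push_cast <;> ring

theorem mainTheorem6 (n : ℕ) (hn : 1 ≤ n) :
    (partitionQ n : ℚ) = hurwitzH (8 * n - 1) := by
  have hN : ((8 * n - 1 : ℕ) : ℤ) = 8 * n - 1 := by omega
  rw [hurwitzH_eq_card (by omega), FormClass.card_eq_card_isReduced (by omega), hN,
    partitionQ_eq_card (by omega), card_consecutiveData,
    Nat.card_congr (BinaryForm.reducedTwoEquiv n)]
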